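/- Let $b\ge 2$ be an integer and $\omega_b=e^{2\pi\sqrt{-1}/b}$. Let $\alpha$ and $k$ be positive integers, and write $k=\kappa_1b^{a_1-1}+\dots+\kappa_vb^{a_v-1}$ with integers $1\le\kappa_i\le b-1$ and $a_1>\dots>a_v\ge1$, so that $v\ge 1$ is the number of nonzero $b$-adic digits of $k$. The $b$-adic $k$-th Walsh function is $\mathrm{wal}_k(x)=\omega_b^{\sum_{i=1}^v\kappa_i\xi_{a_i}}$ for $x=\xi_1b^{-1}+\xi_2b^{-2}+\cdots\in[0,1)$ (digit expansion with infinitely many digits different from $b-1$), and $\widehat f(k)=\int_0^1 f(x)\overline{\mathrm{wal}_k(x)}\,dx$. For $i\ge1$ put $$\mu_{i,\mathrm{per}}(k)=\begin{cases}a_1+\dots+a_v+(i-v)a_v & \text{if } v\le i,\\ a_1+\dots+a_i & \text{if } v\ge i.\end{cases}$$ Put $m_b=\min_{1\le c\le b-1}|1-\omega_b^{-c}|$ and $M_b=\max_{1\le c\le b-1}|1-\omega_b^{-c}|$, and for $b>2$ put $$C_{b,v}=\frac{b\,m_b}{b-M_b}\left(1-\left(\frac{M_b}{b}\right)^{v}\right).$$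 **Theorem.** Let $f\colon[0,1]\to\mathbb R$ belong to the unanchored Sobolev space $\mathcal H_\alpha$, i.e. $f^{(i)}$ exists and is absolutely continuous on $[0,1]$ for $i=0,\dots,\alpha-1$, and $f^{(\alpha)}\in L^2[0,1]$. If $b>2$, then $$|\widehat f(k)|\le\sum_{i=v}^{\alpha}\left|\int_0^1f^{(i)}(x)\,dx\right|\frac{b^{-\mu_{i,\mathrm{per}}(k)}}{m_b^{i}}\,(1+C_{b,v})+\int_0^1|f^{(\alpha)}(x)|\,dx\;\frac{b^{-\mu_{\alpha,\mathrm{per}}(k)}}{m_b^{\alpha}}\,(M_b+C_{b,v}),$$ and if $b=2$, then $$|\widehat f(k)|\le\sum_{\substack{v\le i\le\alpha\\ i\equiv v\ (\mathrm{mod}\ 2)}}\left|\int_0^1f^{(i)}(x)\,dx\right|\frac{2^{-\mu_{i,\mathrm{per}}(k)}}{2^{i}}+\int_0^1|f^{(\alpha)}(x)|\,dx\;\frac{2^{-\mu_{\alpha,\mathrm{per}}(k)}}{2^{\alpha-1}}.$$ For $v>\alpha$ the sums over $i$ are empty and equal to $0$. -/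

import Mathlib

/-- The digit of `k` in base `b` that stands in front of `b ^ (a - 1)`, for `a ≥ 1`. -/
def walshDigit (b k a : ℕ) : ℕ := (Nat.digits b k).getD (a - 1) 0

/-- The positions `a ≥ 1` of the nonzero `b`-adic digits of `k`, i.e. the set `{a_1, ..., a_v}`
where `k = κ_1 b ^ (a_1 - 1) + ... + κ_v b ^ (a_v - 1)` with all `κ_i ≠ 0`. -/
def walshPositions (b k : ℕ) : Finset ℕ :=
  {a ∈ Finset.Icc 1 (Nat.digits b k).length | walshDigit b k a ≠ 0}

/-- The Hamming weight `v` of `k`: its number of nonzero `b`-adic digits. -/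
def walshWeight (b k : ℕ) : ℕ := (walshPositions b k).card

/-- `a_i` for `1 ≤ i ≤ v`, where `a_1 > ... > a_v`. -/
def walshPos (b k i : ℕ) : ℕ := ((walshPositions b k).sort (· ≥ ·)).getD (i - 1) 0

/-- The `b`-adic `k`-th Walsh function on `[0, 1)`. The digit `ξ_a` of `x = ∑ ξ_a b ^ (-a)` is
`Real.digits x b (a - 1) = ⌊x * b ^ a⌋ mod b`, the digit expansion in which infinitely many digits
are different from `b - 1`. -/
noncomputable def walsh (b : ℕ) [NeZero b] (k : ℕ) (x : ℝ) : ℂ :=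
  Complex.exp (2 * Real.pi * Complex.I / b) ^
    (∑ a ∈ walshPositions b k, walshDigit b k a * (Real.digits x b (a - 1) : ℕ))

/-- The `k`-th `b`-adic Walsh coefficient of `f : [0, 1) → ℝ`. -/
noncomputable def walshCoeff (b : ℕ) [NeZero b] (f : ℝ → ℝ) (k : ℕ) : ℂ :=
  ∫ x in Set.Ico (0 : ℝ) 1, (f x : ℂ) * starRingEnd ℂ (walsh b k x)

/-- `μ_{α, per}(k)`. -/
def muPer (b α k : ℕ) : ℕ :=
  if k = 0 then 0
  else if walshWeight b k ≤ α then
    ∑ i ∈ Finset.Icc 1 (walshWeight b k), walshPos b k i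
      + (α - walshWeight b k) * walshPos b k (walshWeight b k)
  else ∑ i ∈ Finset.Icc 1 α, walshPos b k i

/-- The numbers `|1 - ω ^ (-c)|` for `c = 1, ..., b - 1`, where `ω = exp (2 π i / b)`. -/
noncomputable def rootDistances (b : ℕ) : Set ℝ :=
  (fun c : ℕ => ‖1 - starRingEnd ℂ (Complex.exp (2 * Real.pi * Complex.I / b)) ^ c‖) ''
    Set.Icc 1 (b - 1)

/-- `m_b = min_{1 ≤ c ≤ b - 1} |1 - ω ^ (-c)|` (a finite nonempty set of numbers for `b ≥ 2`). -/
noncomputable def mMin (b : ℕ) : ℝ := sInf (rootDistances b)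

/-- `M_b = max_{1 ≤ c ≤ b - 1} |1 - ω ^ (-c)|` (a finite nonempty set of numbers for `b ≥ 2`). -/
noncomputable def mMax (b : ℕ) : ℝ := sSup (rootDistances b)

/-- The constant `b m_b / (b - M_b) * (1 - (M_b / b) ^ v)`. -/
noncomputable def walshConst (b v : ℕ) : ℝ :=
  b * mMin b / (b - mMax b) * (1 - (mMax b / b) ^ v)

/-- The `i`-th derivative of `f : [0, 1] → ℝ` (one-sided at the end points). -/
noncomputable def derivUnit (i : ℕ) (f : ℝ → ℝ) : ℝ → ℝ :=
  iteratedDerivWithin i f (Set.Icc 0 1)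

/-- The unanchored Sobolev space of order `α`: the functions `f` on `[0, 1]` (values outside
`[0, 1]` play no role) whose derivatives of order `< α` exist and are absolutely continuous on
`[0, 1]`, and whose `α`-th derivative, which then exists almost everywhere, is in `L²[0, 1]`. -/
structure MemSobolevUnit (α : ℕ) (f : ℝ → ℝ) : Prop where
  differentiableOn : ∀ i, i + 1 < α → DifferentiableOn ℝ (derivUnit i f) (Set.Icc 0 1)
  absolutelyContinuous : ∀ i < α, AbsolutelyContinuousOnInterval (derivUnit i f) 0 1
  memLp : MeasureTheory.MemLp (derivUnit α f) 2
    (MeasureTheory.volume.restrict (Set.Icc (0 : ℝ) 1))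

open MeasureTheory

/-! The conjugate Walsh function is a product of step characters `stepChar (L i) (z i)` with `L i =
b^(-a_{i+1})`, `z i = ω^(-κ_{i+1})`. Integrating by parts `α` times against successive primitives `ψ
n` of it that take equal values at 0 and 1 gives `MemSobolevUnit.integral_mul_iter`: the boundary
term of step `i` collapses to `ψ (i+1) 0` times the integral of the derivative of order `i + 1`.
Everything thus reduces to choosing primitives and bounding them.

If `g (x + L) = z * g x` with `z ≠ 1`, exactly one primitive has the same quasi-period, namely
`quasiPrim`, and it costs a factor `L / ‖1 - z‖`. The factors are absorbed from the finest scale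
upwards. The first `n` of them, integrated `n` times, give `towerPrim n` plus the constant
`towerMean n`; this sum vanishes at all multiples of the next length, so multiplying by the
remaining, coarser factors preserves primitives (`IsPrimitive.mul_isStep`). Hence `iterPrim n`
vanishes at 0 for `0 < n < v`, which is why the sum starts at `i = v`. Once all factors are
absorbed, each further integration costs `L (v-1) / m`, the source of `(i - v) a_v` in `muPer`.

For `b > 2` a recursion bounds `towerPrim` by `b/(b-2)` times the product of the `L i / m`;
trigonometric estimates of `mMin` and `mMax` show that this is within the stated constants. For `b =
2` that constant degenerates; positivity replaces it by 1, and parity under `x ↦ -x` kills every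
second boundary term. -/

/-! ### Primitives of quasi-periodic functions -/

/-- `G` is a primitive of the locally integrable function `g`. -/
structure IsPrimitive (G g : ℝ → ℂ) : Prop where
  integrable : ∀ x y, IntervalIntegrable g volume x y
  integral : ∀ x y, ∫ t in x..y, g t = G y - G x

lemma IsPrimitive.continuous {G g : ℝ → ℂ} (h : IsPrimitive G g) : Continuous G := by
  have h1 : G = fun y => G 0 + ∫ t in (0 : ℝ)..y, g t := by
    funext y
    rw [h.integral]
    ring
  rw [h1]
  exact continuous_const.add (intervalIntegral.continuous_primitive h.integrable 0)

lemma IsPrimitive.add_const {G g : ℝ → ℂ} (h : IsPrimitive G g) (c : ℂ) :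
    IsPrimitive (fun x => G x + c) g :=
  ⟨h.integrable, fun x y => by rw [h.integral]; ring⟩

/-- The quasi-periodic primitive of a function `g` with `g (x + L) = z * g x`. -/
noncomputable def quasiPrim (L : ℝ) (z : ℂ) (g : ℝ → ℂ) (x : ℝ) : ℂ :=
  (z - 1)⁻¹ * ∫ t in x..x + L, g t

lemma integral_add_quasiperiod {L : ℝ} {z : ℂ} {g : ℝ → ℂ} (hq : ∀ x, g (x + L) = z * g x)
    (x y : ℝ) : ∫ t in x + L..y + L, g t = z * ∫ t in x..y, g t := by
  rw [← intervalIntegral.integral_comp_add_right, ← intervalIntegral.integral_const_mul]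
  simp_rw [hq]

/-- Moving the window `[x, x + L]` to `[y, y + L]` changes the integral by that over `[x + L, y +
L]` minus that over `[x, y]`, which is `z - 1` times the latter. -/
lemma isPrimitive_quasiPrim {L : ℝ} {z : ℂ} {g : ℝ → ℂ} (hz : z ≠ 1)
    (hg : ∀ x y, IntervalIntegrable g volume x y) (hq : ∀ x, g (x + L) = z * g x) :
    IsPrimitive (quasiPrim L z g) g := by
  refine ⟨hg, fun x y => ?_⟩
  have hz' : z - 1 ≠ 0 := sub_ne_zero.mpr hz
  have h1 : (∫ t in y..y + L, g t) - ∫ t in x..x + L, g t = (z - 1) * ∫ t in x..y, g t := by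
    rw [sub_mul, ← integral_add_quasiperiod hq, one_mul,
      ← intervalIntegral.integral_add_adjacent_intervals (hg y (x + L)) (hg (x + L) (y + L)),
      ← intervalIntegral.integral_add_adjacent_intervals (hg x y) (hg y (x + L))]
    ring
  rw [quasiPrim, quasiPrim, ← mul_sub, h1, inv_mul_cancel_left₀ hz']

lemma quasiPrim_add_quasiperiod {L : ℝ} {z : ℂ} {g : ℝ → ℂ} (hq : ∀ x, g (x + L) = z * g x)
    (x : ℝ) : quasiPrim L z g (x + L) = z * quasiPrim L z g x := by
  rw [quasiPrim, quasiPrim, integral_add_quasiperiod hq]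
  ring

lemma norm_quasiPrim_le {L C : ℝ} {z : ℂ} {g : ℝ → ℂ} (hL : 0 ≤ L) (hg : ∀ x, ‖g x‖ ≤ C)
    (x : ℝ) : ‖quasiPrim L z g x‖ ≤ L / ‖1 - z‖ * C := by
  have h := intervalIntegral.norm_integral_le_of_norm_le_const (a := x) (b := x + L) (f := g)
    (fun t _ => hg t)
  rw [add_sub_cancel_left, abs_of_nonneg hL] at h
  rw [quasiPrim, norm_mul, norm_inv, norm_sub_rev, div_mul_eq_mul_div, div_eq_inv_mul]
  gcongr
  linarith

lemma add_nat_mul_quasiperiod {L : ℝ} {z : ℂ} {g : ℝ → ℂ} (hq : ∀ x, g (x + L) = z * g x)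
    (n : ℕ) (x : ℝ) : g (x + n * L) = z ^ n * g x := by
  induction n with
  | zero => simp
  | succ n ih =>
    rw [pow_succ', mul_assoc, ← ih, ← hq]
    congr 1
    push_cast
    ring

/-! ### Step functions and step characters -/

/-- `R` is constant on the intervals `[q L, (q + 1) L)`. -/
def IsStep (L : ℝ) (R : ℝ → ℂ) : Prop := ∀ x y, ⌊x / L⌋ = ⌊y / L⌋ → R x = R y

lemma floor_div_nat_mul {L : ℝ} (n : ℕ) (x : ℝ) :
    ⌊x / (n * L)⌋ = ⌊x / L⌋ / (n : ℤ) := by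
  rw [mul_comm, ← div_div, Int.floor_div_natCast]

lemma IsStep.of_nat_mul {L : ℝ} {R : ℝ → ℂ} {n : ℕ} (hR : IsStep (n * L) R) : IsStep L R :=
  fun x y h => hR x y (by rw [floor_div_nat_mul, floor_div_nat_mul, h])

lemma IsStep.measurable {L : ℝ} {R : ℝ → ℂ} (hR : IsStep L R) : Measurable R := by
  rcases eq_or_ne L 0 with rfl | hL
  · have : R = fun _ => R 0 := funext fun x => hR x 0 (by simp)
    rw [this]
    exact measurable_const
  · have : R = (fun q : ℤ => R (q * L)) ∘ (fun x : ℝ => ⌊x / L⌋) := by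
      funext x
      refine hR _ _ ?_
      simp [hL]
    rw [this]
    exact (measurable_of_countable _).comp (Int.measurable_floor.comp (measurable_id.div_const L))

lemma IntervalIntegrable.mul_isStep {L C : ℝ} {g R : ℝ → ℂ} {x y : ℝ}
    (hg : IntervalIntegrable g volume x y) (hR : IsStep L R) (hb : ∀ x, ‖R x‖ ≤ C) :
    IntervalIntegrable (fun t => g t * R t) volume x y := by
  rw [intervalIntegrable_iff] at hg ⊢
  exact hg.mul_bdd hR.measurable.aestronglyMeasurable (Filter.Eventually.of_forall hb)

/-- On each cell `R` is a constant factor, and its jumps sit at zeros of `G`, so `G * R` has no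
jumps. -/
lemma IsPrimitive.mul_isStep {L C : ℝ} {G g R : ℝ → ℂ} (hL : 0 < L) (h : IsPrimitive G g)
    (hR : IsStep L R) (hb : ∀ x, ‖R x‖ ≤ C) (h0 : ∀ q : ℤ, G (q * L) = 0) :
    IsPrimitive (fun x => G x * R x) (fun x => g x * R x) := by
  have hint : ∀ x y, IntervalIntegrable (fun t => g t * R t) volume x y :=
    fun x y => (h.integrable x y).mul_isStep hR hb
  have hpiece : ∀ (q : ℤ) (y : ℝ), q * L ≤ y → y ≤ (q + 1) * L →
      ∫ t in (q * L)..y, g t * R t = G y * R y := by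
    intro q y h1 h2
    have hfl : ∀ t, q * L ≤ t → t < (q + 1) * L → R t = R (q * L) := by
      intro t ht1 ht2
      refine hR _ _ ?_
      rw [Int.floor_eq_iff.mpr ⟨(le_div_iff₀ hL).mpr ht1, (div_lt_iff₀ hL).mpr ht2⟩]
      simp [hL.ne']
    have h3 : ∫ t in (q * L)..y, g t * R t = ∫ t in (q * L)..y, g t * R (q * L) := by
      apply intervalIntegral.integral_congr_ae
      have : ∀ᵐ t : ℝ, t ≠ (q + 1) * L := by
        simp [ae_iff]
      filter_upwards [this] with t ht ht'
      rw [Set.uIoc_of_le h1] at ht'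
      rw [hfl t ht'.1.le (lt_of_le_of_ne (ht'.2.trans h2) ht)]
    rw [h3, intervalIntegral.integral_mul_const, h.integral, h0, sub_zero]
    -- At the right end of the cell `R` may already have jumped, but there `G` vanishes.
    rcases h2.lt_or_eq with h4 | h4
    · rw [hfl y h1 h4]
    · have := h0 (q + 1)
      push_cast at this
      rw [h4, this]
      simp
  have hq : ∀ q : ℤ, ∫ t in (0 : ℝ)..(q * L), g t * R t = 0 := by
    have hstep : ∀ q : ℤ, ∫ t in (q * L)..((q + 1 : ℤ) * L), g t * R t = 0 := by
      intro q
      rw [hpiece q _ (by push_cast; nlinarith) (by push_cast; rfl), h0]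
      simp
    intro q
    induction q using Int.induction_on with
    | zero => simp
    | succ n ih =>
      rw [← intervalIntegral.integral_add_adjacent_intervals (hint _ _) (hint _ _), ih, hstep,
        zero_add]
    | pred n ih =>
      have := hstep (-n - 1)
      rw [sub_add_cancel] at this
      rw [← intervalIntegral.integral_add_adjacent_intervals
        (hint _ (((-n - 1 : ℤ) : ℝ) * L)) (hint _ _), this, add_zero] at ih
      exact ih
  have h00 : ∀ y, ∫ t in (0 : ℝ)..y, g t * R t = G y * R y := by
    intro y
    rw [← intervalIntegral.integral_add_adjacent_intervals
      (hint _ ((⌊y / L⌋ : ℝ) * L)) (hint _ _), hq, zero_add]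
    exact hpiece _ _ ((le_div_iff₀ hL).mp (Int.floor_le _))
      ((div_le_iff₀ hL).mp (Int.lt_floor_add_one _).le)
  refine ⟨hint, fun x y => ?_⟩
  rw [← intervalIntegral.integral_interval_sub_left (hint 0 y) (hint 0 x), h00, h00]

/-- The step function with value `z ^ q` on `[q L, (q + 1) L)`. -/
noncomputable def stepChar (L : ℝ) (z : ℂ) (x : ℝ) : ℂ := z ^ ⌊x / L⌋

lemma isStep_stepChar (L : ℝ) (z : ℂ) : IsStep L (stepChar L z) := fun x y h => by
  rw [stepChar, stepChar, h]

lemma norm_stepChar {L : ℝ} {z : ℂ} (hz : ‖z‖ = 1) (x : ℝ) : ‖stepChar L z x‖ = 1 := by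
  rw [stepChar, norm_zpow, hz, one_zpow]

lemma stepChar_add {L : ℝ} {z : ℂ} (hL : L ≠ 0) (hz : ‖z‖ = 1) (x : ℝ) :
    stepChar L z (x + L) = z * stepChar L z x := by
  have hz0 : z ≠ 0 := norm_ne_zero_iff.mp (by rw [hz]; exact one_ne_zero)
  rw [stepChar, stepChar, add_div, div_self hL, Int.floor_add_one, zpow_add_one₀ hz0, mul_comm]

lemma intervalIntegrable_stepChar {L : ℝ} {z : ℂ} (hz : ‖z‖ = 1) (x y : ℝ) :
    IntervalIntegrable (stepChar L z) volume x y := by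
  simpa using (intervalIntegrable_const (c := (1 : ℂ)) (a := x) (b := y)
    (μ := volume)).mul_isStep (isStep_stepChar L z) (fun x => (norm_stepChar hz x).le)

/-! ### Towers of step characters -/

/-- Data of a product of `v` step characters of lengths `L 0, ..., L (v - 1)` such that each of
them is periodic with respect to the length of the next one. -/
structure StepTower (b v : ℕ) (L : ℕ → ℝ) (z : ℕ → ℂ) : Prop where
  pos : ∀ i < v, 0 < L i
  norm : ∀ i < v, ‖z i‖ = 1
  ne_one : ∀ i < v, z i ≠ 1
  pow_eq_one : ∀ i < v, z i ^ b = 1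
  dvd_succ : ∀ i, i + 1 < v → ∃ q : ℕ, L (i + 1) = q * (b * L i)
  dvd_one : ∀ i < v, ∃ q : ℕ, 1 = q * (b * L i)

/-- The mean value of the `n`-fold iterated integral of the first `n` step characters. -/
noncomputable def towerMean (L : ℕ → ℝ) (z : ℕ → ℂ) (n : ℕ) : ℂ :=
  ∏ i ∈ Finset.range n, (L i : ℂ) / (1 - z i)

/-- The `n`-fold iterated mean-zero integral of the product of the first `n` step characters. -/
noncomputable def towerPrim (L : ℕ → ℝ) (z : ℕ → ℂ) : ℕ → ℝ → ℂ
  | 0 => 0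
  | n + 1 => quasiPrim (L n) (z n)
      (fun x => (towerPrim L z n x + towerMean L z n) * stepChar (L n) (z n) x)

lemma add_nat_mul_period {b q : ℕ} {L : ℝ} {z : ℂ} {g : ℝ → ℂ} (hz : z ^ b = 1)
    (hq : ∀ x, g (x + L) = z * g x) (x : ℝ) : g (x + q * (b * L)) = g x := by
  have := add_nat_mul_quasiperiod hq (q * b) x
  rw [mul_comm q b, pow_mul, hz, one_pow, one_mul] at this
  rw [← this]
  congr 1
  push_cast
  ring

lemma int_mul_period {L : ℝ} {g : ℝ → ℂ} (hg : ∀ x, g (x + L) = g x) (q : ℤ) :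
    g (q * L) = g 0 := by
  have : Function.Periodic g L := hg
  have := this.int_mul q 0
  rwa [zero_add] at this

lemma quasiPrim_stepChar_zero {L : ℝ} {z : ℂ} (hL : 0 < L) :
    quasiPrim L z (stepChar L z) 0 = L / (z - 1) := by
  have : ∫ t in (0 : ℝ)..0 + L, stepChar L z t = ∫ t in (0 : ℝ)..0 + L, (1 : ℂ) := by
    apply intervalIntegral.integral_congr_ae
    have : ∀ᵐ t : ℝ, t ≠ L := by simp [ae_iff]
    filter_upwards [this] with t ht ht'
    rw [zero_add, Set.uIoc_of_le hL.le] at ht'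
    have h1 : ⌊t / L⌋ = 0 := by
      rw [Int.floor_eq_iff]
      have := lt_of_le_of_ne ht'.2 ht
      refine ⟨by simpa using div_nonneg ht'.1.le hL.le, ?_⟩
      simpa using (div_lt_one hL).mpr this
    rw [stepChar, h1, zpow_zero]
  rw [quasiPrim, this]
  simp [div_eq_inv_mul]

namespace StepTower

variable {b v : ℕ} {L : ℕ → ℝ} {z : ℕ → ℂ}

lemma integrable_aux (h : StepTower b v L z) {n : ℕ} (hn : n < v)
    (hc : Continuous (towerPrim L z n)) (x y : ℝ) :
    IntervalIntegrable (fun x => (towerPrim L z n x + towerMean L z n) * stepChar (L n) (z n) x)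
      volume x y :=
  ((hc.add continuous_const).intervalIntegrable x y).mul_isStep (isStep_stepChar _ _)
    (fun x => (norm_stepChar (h.norm n hn) x).le)

lemma quasi_aux (h : StepTower b v L z) {n : ℕ} (hn : n < v)
    (hp : ∀ x, towerPrim L z n (x + L n) = towerPrim L z n x) (x : ℝ) :
    (towerPrim L z n (x + L n) + towerMean L z n) * stepChar (L n) (z n) (x + L n)
      = z n * ((towerPrim L z n x + towerMean L z n) * stepChar (L n) (z n) x) := by
  rw [hp, stepChar_add (h.pos n hn).ne' (h.norm n hn)]
  ring

/-- Quasi-periodicity with factor `z n` at scale `L n` is true periodicity at scale `b * L n`,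
because `z n ^ b = 1`; the next length is a multiple of that. -/
lemma continuous_and_periodic (h : StepTower b v L z) {n : ℕ} (hn : n < v) :
    Continuous (towerPrim L z n) ∧ ∀ x, towerPrim L z n (x + L n) = towerPrim L z n x := by
  induction n with
  | zero => exact ⟨continuous_const, fun x => rfl⟩
  | succ n ih =>
    have hn' : n < v := by omega
    obtain ⟨hc, hp⟩ := ih hn'
    refine ⟨(isPrimitive_quasiPrim (h.ne_one n hn') (h.integrable_aux hn' hc)
      (h.quasi_aux hn' hp)).continuous, fun x => ?_⟩
    obtain ⟨q, hq⟩ := h.dvd_succ n hn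
    rw [hq]
    exact add_nat_mul_period (h.pow_eq_one n hn')
      (quasiPrim_add_quasiperiod (h.quasi_aux hn' hp)) x

lemma isPrimitive (h : StepTower b v L z) {n : ℕ} (hn : n < v) :
    IsPrimitive (towerPrim L z (n + 1))
      (fun x => (towerPrim L z n x + towerMean L z n) * stepChar (L n) (z n) x) :=
  isPrimitive_quasiPrim (h.ne_one n hn) (h.integrable_aux hn (h.continuous_and_periodic hn).1)
    (h.quasi_aux hn (h.continuous_and_periodic hn).2)

lemma quasi (h : StepTower b v L z) {n : ℕ} (hn : n < v) (x : ℝ) :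
    towerPrim L z (n + 1) (x + L n) = z n * towerPrim L z (n + 1) x :=
  quasiPrim_add_quasiperiod (h.quasi_aux hn (h.continuous_and_periodic hn).2) x

lemma towerPrim_one : towerPrim L z 1 = quasiPrim (L 0) (z 0) (stepChar (L 0) (z 0)) := by
  simp [towerPrim, towerMean]

/-- The integrand splits into the mean times the character and a periodic mean-zero part times the
character. The second has an explicit primitive: a primitive of the periodic part, normalized to
vanish at 0 and hence at all multiples of `L (n + 1)`, times the character. It gains a factor `L n`
instead of the larger `L (n + 1)`. -/
lemma towerPrim_succ_succ (h : StepTower b v L z) {n : ℕ} (hn : n + 1 < v) (x : ℝ) :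
    towerPrim L z (n + 2) x =
      towerMean L z (n + 1) * quasiPrim (L (n + 1)) (z (n + 1)) (stepChar (L (n + 1)) (z (n + 1))) x
      + (quasiPrim (L n) (z n) (towerPrim L z (n + 1)) x
          - quasiPrim (L n) (z n) (towerPrim L z (n + 1)) 0)
        * stepChar (L (n + 1)) (z (n + 1)) x := by
  have hn' : n < v := by omega
  have hc := (h.isPrimitive hn').continuous
  set U := quasiPrim (L n) (z n) (towerPrim L z (n + 1)) with hU
  have hUp : IsPrimitive U (towerPrim L z (n + 1)) :=
    isPrimitive_quasiPrim (h.ne_one n hn') (hc.intervalIntegrable) (h.quasi hn')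
  have hUper : ∀ x, U (x + L (n + 1)) = U x := by
    intro x
    obtain ⟨q, hq⟩ := h.dvd_succ n hn
    rw [hq]
    exact add_nat_mul_period (h.pow_eq_one n hn') (quasiPrim_add_quasiperiod (h.quasi hn')) x
  have hprod := (hUp.add_const (-U 0)).mul_isStep (h.pos _ hn)
    (isStep_stepChar (L (n + 1)) (z (n + 1))) (fun x => (norm_stepChar (h.norm _ hn) x).le)
    (fun q => by rw [int_mul_period hUper, add_neg_cancel])
  have hz : z (n + 1) - 1 ≠ 0 := sub_ne_zero.mpr (h.ne_one _ hn)
  have hχ := intervalIntegrable_stepChar (L := L (n + 1)) (h.norm _ hn) x (x + L (n + 1))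
  have hint : ∫ t in x..x + L (n + 1),
      (towerPrim L z (n + 1) t + towerMean L z (n + 1)) * stepChar (L (n + 1)) (z (n + 1)) t
      = (z (n + 1) - 1) * ((U x - U 0) * stepChar (L (n + 1)) (z (n + 1)) x)
        + towerMean L z (n + 1) * ∫ t in x..x + L (n + 1), stepChar (L (n + 1)) (z (n + 1)) t := by
    simp_rw [add_mul]
    rw [intervalIntegral.integral_add (hprod.integrable _ _) (hχ.const_mul _), hprod.integral,
      intervalIntegral.integral_const_mul, hUper, stepChar_add (h.pos _ hn).ne' (h.norm _ hn)]
    ring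
  rw [towerPrim, quasiPrim, hint, quasiPrim]
  field_simp
  ring

/-- In the decomposition of `towerPrim_succ_succ` the second summand vanishes at 0, and the first is
explicit there. This makes `towerPrim + towerMean` vanish at the nodes of the next scale. -/
lemma towerPrim_succ_zero (h : StepTower b v L z) {n : ℕ} (hn : n < v) :
    towerPrim L z (n + 1) 0 = -towerMean L z (n + 1) := by
  have h1 : 1 - z n ≠ 0 := sub_ne_zero.mpr (h.ne_one n hn).symm
  have h2 : z n - 1 ≠ 0 := sub_ne_zero.mpr (h.ne_one n hn)
  have key : towerPrim L z (n + 1) 0 = towerMean L z n * (L n / (z n - 1)) := by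
    rw [← quasiPrim_stepChar_zero (h.pos n hn)]
    cases n with
    | zero => rw [towerPrim_one]; simp [towerMean]
    | succ n => rw [h.towerPrim_succ_succ hn, sub_self, zero_mul, add_zero]
  rw [key, towerMean, towerMean, Finset.prod_range_succ, ← neg_sub 1 (z n), div_neg, mul_neg]

lemma norm_towerMean_le (h : StepTower b v L z) {m : ℝ} (hm : 0 < m)
    (hmz : ∀ i < v, m ≤ ‖1 - z i‖) {n : ℕ} (hn : n ≤ v) :
    ‖towerMean L z n‖ ≤ ∏ i ∈ Finset.range n, L i / m := by
  rw [towerMean, norm_prod]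
  refine Finset.prod_le_prod (fun i _ => norm_nonneg _) (fun i hi => ?_)
  have hi' : i < v := (Finset.mem_range.mp hi).trans_le hn
  rw [norm_div, Complex.norm_of_nonneg (h.pos i hi').le]
  exact div_le_div_of_nonneg_left (h.pos i hi').le hm (hmz i hi')

lemma prod_div_nonneg (h : StepTower b v L z) {m : ℝ} (hm : 0 < m) {n : ℕ} (hn : n ≤ v) :
    0 ≤ ∏ i ∈ Finset.range n, L i / m :=
  Finset.prod_nonneg fun i hi =>
    div_nonneg (h.pos i ((Finset.mem_range.mp hi).trans_le hn)).le hm.le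

lemma norm_quasiPrim_le' (h : StepTower b v L z) {m : ℝ} (hm : 0 < m)
    (hmz : ∀ i < v, m ≤ ‖1 - z i‖) {n : ℕ} (hn : n < v) {g : ℝ → ℂ} {C : ℝ}
    (hg : ∀ x, ‖g x‖ ≤ C) (x : ℝ) : ‖quasiPrim (L n) (z n) g x‖ ≤ L n / m * C := by
  refine (norm_quasiPrim_le (h.pos n hn).le hg x).trans ?_
  exact mul_le_mul_of_nonneg_right (div_le_div_of_nonneg_left (h.pos n hn).le hm (hmz n hn))
    ((norm_nonneg _).trans (hg 0))

lemma norm_towerPrim_one_le (h : StepTower b v L z) {m : ℝ} (hm : 0 < m)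
    (hmz : ∀ i < v, m ≤ ‖1 - z i‖) (hv : 0 < v) (x : ℝ) :
    ‖towerPrim L z 1 x‖ ≤ ∏ i ∈ Finset.range 1, L i / m := by
  rw [towerPrim_one, Finset.prod_range_one]
  simpa using h.norm_quasiPrim_le' hm hmz hv (fun x => (norm_stepChar (h.norm 0 hv) x).le) x

lemma mul_le_succ (h : StepTower b v L z) (hb : 0 < b) {n : ℕ} (hn : n + 1 < v) :
    b * L n ≤ L (n + 1) := by
  obtain ⟨q, hq⟩ := h.dvd_succ n hn
  have h1 := h.pos _ hn
  have h2 : (0 : ℝ) < b * L n := mul_pos (by exact_mod_cast hb) (h.pos n (by omega))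
  have h3 : q ≠ 0 := by
    rintro rfl
    simp at hq
    linarith
  have h4 : (1 : ℝ) ≤ q := by exact_mod_cast Nat.one_le_iff_ne_zero.mpr h3
  rw [hq]
  nlinarith

/-- Since `L n ≤ L (n + 1) / b`, the decomposition turns a bound with constant `c` into one with `1
+ 2 c / b`; the fixed point of this map is `b / (b - 2)`. -/
lemma norm_towerPrim_le (h : StepTower b v L z) {m : ℝ} (hm : 0 < m)
    (hmz : ∀ i < v, m ≤ ‖1 - z i‖) (hb : 2 < b) {n : ℕ} (hn : n < v) (x : ℝ) :
    ‖towerPrim L z (n + 1) x‖ ≤ (b / (b - 2) : ℝ) * ∏ i ∈ Finset.range (n + 1), L i / m := by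
  have hb' : (2 : ℝ) < b := by exact_mod_cast hb
  have hb2 : (0 : ℝ) < b - 2 := by linarith
  have he : (1 : ℝ) ≤ b / (b - 2) := by rw [le_div_iff₀ hb2]; linarith
  induction n generalizing x with
  | zero =>
    refine (h.norm_towerPrim_one_le hm hmz hn x).trans ?_
    exact le_mul_of_one_le_left (h.prod_div_nonneg hm hn) he
  | succ n ih =>
    have hn' : n < v := by omega
    set P := ∏ i ∈ Finset.range (n + 1), L i / m with hP
    have hP0 : 0 ≤ P := h.prod_div_nonneg hm hn'
    have hχ := fun x => norm_stepChar (L := L (n + 1)) (h.norm (n + 1) hn) x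
    have h1 := h.norm_quasiPrim_le' hm hmz hn (fun x => (hχ x).le) x
    have h2 := h.norm_quasiPrim_le' hm hmz hn' (fun x => ih hn' x)
    have h3 := h.norm_towerMean_le hm hmz (n := n + 1) hn.le
    have h4 := h.mul_le_succ (by omega) hn
    rw [mul_one] at h1
    rw [h.towerPrim_succ_succ hn, Finset.prod_range_succ, ← hP]
    have h5 : L n / m ≤ (L (n + 1) / m) / b := by
      rw [div_div, mul_comm m, ← div_div]
      gcongr
      rw [le_div_iff₀ (by linarith)]
      linarith
    calc _ ≤ ‖towerMean L z (n + 1)‖ * (L (n + 1) / m)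
          + (L n / m * (b / (b - 2) * P) + L n / m * (b / (b - 2) * P)) * 1 := by
          refine (norm_add_le _ _).trans ?_
          rw [norm_mul, norm_mul, hχ]
          gcongr
          exact (norm_sub_le _ _).trans (add_le_add (h2 x) (h2 0))
      _ ≤ P * (L (n + 1) / m)
          + ((L (n + 1) / m) / b * (b / (b - 2) * P) + (L (n + 1) / m) / b * (b / (b - 2) * P))
            * 1 := by
          have := h.pos _ hn
          gcongr
      _ = _ := by
          field_simp
          ring

/-! ### Iterated primitives of the full product -/

/-- The `n`-fold iterated mean-zero integral of the product of all step characters. -/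
noncomputable def _root_.iterPrim (v : ℕ) (L : ℕ → ℝ) (z : ℕ → ℂ) (n : ℕ) : ℝ → ℂ :=
  if n < v then fun x => (towerPrim L z n x + towerMean L z n)
    * ∏ i ∈ Finset.Ico n v, stepChar (L i) (z i) x
  else (quasiPrim (L (v - 1)) (z (v - 1)))^[n - v] (towerPrim L z v)

lemma iterPrim_of_lt {n : ℕ} (hn : n < v) (x : ℝ) :
    iterPrim v L z n x = (towerPrim L z n x + towerMean L z n)
      * ∏ i ∈ Finset.Ico n v, stepChar (L i) (z i) x := by
  rw [iterPrim, if_pos hn]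

lemma iterPrim_self : iterPrim v L z v = towerPrim L z v := by
  rw [iterPrim, if_neg (lt_irrefl v), Nat.sub_self, Function.iterate_zero, id]

lemma iterPrim_succ {n : ℕ} (hn : v ≤ n) :
    iterPrim v L z (n + 1) = quasiPrim (L (v - 1)) (z (v - 1)) (iterPrim v L z n) := by
  rw [iterPrim, if_neg (by omega), iterPrim, if_neg (by omega), Nat.succ_sub hn,
    Function.iterate_succ_apply']

lemma exists_nat_mul (h : StepTower b v L z) {i j : ℕ} (hij : i ≤ j) (hj : j < v) :
    ∃ q : ℕ, L j = q * L i := by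
  induction j, hij using Nat.le_induction with
  | base => exact ⟨1, by simp⟩
  | succ j hij ih =>
    obtain ⟨q, hq⟩ := ih (by omega)
    obtain ⟨r, hr⟩ := h.dvd_succ j hj
    exact ⟨r * b * q, by rw [hr, hq]; push_cast; ring⟩

lemma isStep_prod (h : StepTower b v L z) (n : ℕ) :
    IsStep (L n) (fun x => ∏ i ∈ Finset.Ico n v, stepChar (L i) (z i) x) := by
  intro x y hxy
  refine Finset.prod_congr rfl fun i hi => ?_
  rw [Finset.mem_Ico] at hi
  obtain ⟨q, hq⟩ := h.exists_nat_mul hi.1 hi.2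
  have := isStep_stepChar (L i) (z i)
  rw [hq] at this ⊢
  exact this.of_nat_mul x y hxy

lemma norm_prod_stepChar (h : StepTower b v L z) (n : ℕ) (x : ℝ) :
    ‖∏ i ∈ Finset.Ico n v, stepChar (L i) (z i) x‖ = 1 := by
  rw [norm_prod]
  exact Finset.prod_eq_one fun i hi => norm_stepChar (h.norm i (Finset.mem_Ico.mp hi).2) x

lemma iterPrim_quasi (h : StepTower b v L z) (hv : 0 < v) {n : ℕ} (hn : v ≤ n) :
    Continuous (iterPrim v L z n) ∧
    ∀ x, iterPrim v L z n (x + L (v - 1)) = z (v - 1) * iterPrim v L z n x := by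
  obtain ⟨w, rfl⟩ := Nat.exists_eq_add_of_lt hv
  simp only [zero_add, Nat.add_sub_cancel] at *
  have hw : w < w + 1 := by omega
  induction n, hn using Nat.le_induction with
  | base =>
    rw [iterPrim_self]
    exact ⟨(h.isPrimitive hw).continuous, h.quasi hw⟩
  | succ n hn ih =>
    rw [iterPrim_succ hn]
    exact ⟨(isPrimitive_quasiPrim (h.ne_one _ hw) ih.1.intervalIntegrable ih.2).continuous,
      quasiPrim_add_quasiperiod ih.2⟩

lemma isPrimitive_iterPrim (h : StepTower b v L z) (hv : 0 < v) (n : ℕ) :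
    IsPrimitive (iterPrim v L z (n + 1)) (iterPrim v L z n) := by
  rcases lt_trichotomy (n + 1) v with hn | hn | hn
  · have hn' : n < v := by omega
    have hp := (h.isPrimitive hn').add_const (towerMean L z (n + 1))
    have h0 : ∀ q : ℤ, towerPrim L z (n + 1) (q * L (n + 1)) + towerMean L z (n + 1) = 0 := by
      intro q
      rw [int_mul_period (h.continuous_and_periodic hn).2, h.towerPrim_succ_zero hn',
        neg_add_cancel]
    have := hp.mul_isStep (h.pos _ hn) (h.isStep_prod (n + 1))
      (fun x => (h.norm_prod_stepChar (n + 1) x).le) h0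
    convert! this using 1
    · funext x
      rw [iterPrim_of_lt hn]
    · funext x
      rw [iterPrim_of_lt hn', Finset.prod_eq_prod_Ico_succ_bot hn', ← mul_assoc]
  · subst hn
    rw [iterPrim_self]
    have := h.isPrimitive (Nat.lt_succ_self n)
    convert! this using 1
    funext x
    rw [iterPrim_of_lt (Nat.lt_succ_self n)]
    simp
  · have hn' : v ≤ n := by omega
    obtain ⟨hc, hq⟩ := h.iterPrim_quasi hv hn'
    rw [iterPrim_succ hn']
    exact isPrimitive_quasiPrim (h.ne_one _ (by omega)) hc.intervalIntegrable hq

lemma iterPrim_zero_of_lt (h : StepTower b v L z) {n : ℕ} (hn0 : 0 < n) (hn : n < v) :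
    iterPrim v L z n 0 = 0 := by
  obtain ⟨n, rfl⟩ := Nat.exists_eq_add_of_lt hn0
  simp only [zero_add] at *
  rw [iterPrim_of_lt hn, h.towerPrim_succ_zero (by omega), neg_add_cancel, zero_mul]

lemma iterPrim_one (h : StepTower b v L z) {n : ℕ} (hn0 : 0 < n) (hv : 0 < v) :
    iterPrim v L z n 1 = iterPrim v L z n 0 := by
  rcases lt_or_ge n v with hn | hn
  · rw [h.iterPrim_zero_of_lt hn0 hn, iterPrim_of_lt hn]
    obtain ⟨q, hq⟩ := h.dvd_one n hn
    have h1 : (1 : ℝ) = ((q * b : ℕ) : ℤ) * L n := by rw [hq]; push_cast; ring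
    obtain ⟨n, rfl⟩ := Nat.exists_eq_add_of_lt hn0
    simp only [zero_add] at *
    rw [h1, int_mul_period (h.continuous_and_periodic hn).2,
      h.towerPrim_succ_zero (by omega), neg_add_cancel, zero_mul]
  · obtain ⟨q, hq⟩ := h.dvd_one (v - 1) (by omega)
    have := add_nat_mul_period (q := q) (h.pow_eq_one (v - 1) (by omega)) (h.iterPrim_quasi hv hn).2 0
    rwa [← hq, zero_add] at this

lemma norm_iterPrim_le_of_le (h : StepTower b v L z) {m : ℝ} (hm : 0 < m)
    (hmz : ∀ i < v, m ≤ ‖1 - z i‖) (hv : 0 < v) {C : ℝ} (hC : ∀ x, ‖towerPrim L z v x‖ ≤ C)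
    {n : ℕ} (hn : v ≤ n) (x : ℝ) :
    ‖iterPrim v L z n x‖ ≤ (L (v - 1) / m) ^ (n - v) * C := by
  induction n, hn using Nat.le_induction generalizing x with
  | base => rw [iterPrim_self]; simpa using hC x
  | succ n hn ih =>
    rw [iterPrim_succ hn, Nat.succ_sub hn, pow_succ', mul_assoc]
    exact h.norm_quasiPrim_le' hm hmz (by omega) ih x

lemma norm_iterPrim_le_of_lt (h : StepTower b v L z) {m : ℝ} (hm : 0 < m)
    (hmz : ∀ i < v, m ≤ ‖1 - z i‖) {n : ℕ} (hn : n < v) {C : ℝ}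
    (hC : ∀ x, ‖towerPrim L z n x‖ ≤ C) (x : ℝ) :
    ‖iterPrim v L z n x‖ ≤ C + ∏ i ∈ Finset.range n, L i / m := by
  rw [iterPrim_of_lt hn, norm_mul, h.norm_prod_stepChar, mul_one]
  exact (norm_add_le _ _).trans (add_le_add (hC x) (h.norm_towerMean_le hm hmz hn.le))

end StepTower

/-! ### The case of roots equal to -1: parity and positivity -/

lemma quasiPrim_neg {L : ℝ} {ε : ℂ} {g : ℝ → ℂ} (hq : ∀ x, g (x + L) = -1 * g x)
    (hε : ∀ᵐ x, g (-x) = ε * g x) (x : ℝ) :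
    quasiPrim L (-1) g (-x) = -ε * quasiPrim L (-1) g x := by
  have h1 := integral_add_quasiperiod hq (x - L) x
  rw [sub_add_cancel] at h1
  have h2 : ∫ t in (-x)..(-x + L), g t = ε * ∫ t in (x - L)..x, g t := by
    rw [← intervalIntegral.integral_const_mul,
      show -x + L = -(x - L) by ring, ← intervalIntegral.integral_comp_neg]
    apply intervalIntegral.integral_congr_ae
    filter_upwards [hε] with t ht _ using ht
  rw [quasiPrim, quasiPrim, h1, h2]
  ring

/-- Off the nodes, `⌊-t⌋ = -⌊t⌋ - 1`; oddness fails only at the countably many nodes. -/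
lemma stepChar_neg_one_neg {L : ℝ} (hL : L ≠ 0) :
    ∀ᵐ x : ℝ, stepChar L (-1) (-x) = -1 * stepChar L (-1) x := by
  have hc : (Set.range fun q : ℤ => (q : ℝ) * L).Countable := Set.countable_range _
  filter_upwards [hc.ae_notMem volume] with x hx
  have hx' : ⌊-x / L⌋ = -⌊x / L⌋ - 1 := by
    rw [Int.floor_eq_iff]
    have h1 := Int.floor_le (x / L)
    have h2 := Int.lt_floor_add_one (x / L)
    have h3 : (⌊x / L⌋ : ℝ) ≠ x / L := fun h => hx ⟨⌊x / L⌋, by simp only [h]; field_simp⟩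
    have h4 := lt_of_le_of_ne h1 h3
    push_cast
    rw [neg_div]
    constructor <;> linarith
  rw [stepChar, stepChar, hx', zpow_sub₀ (by norm_num), zpow_neg, ← inv_zpow]
  norm_num
  ring

namespace StepTower

variable {b v : ℕ} {L : ℕ → ℝ} {z : ℕ → ℂ}

lemma integral_towerPrim (h : StepTower b v L z) {n : ℕ} (hn : n < v) (x : ℝ) :
    ∫ t in x..x + L n, towerPrim L z n t = 0 := by
  cases n with
  | zero => simp [towerPrim]
  | succ n =>
    have hn' : n < v := by omega
    have hUp := isPrimitive_quasiPrim (h.ne_one n hn')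
      (h.isPrimitive hn').continuous.intervalIntegrable (h.quasi hn')
    obtain ⟨q, hq⟩ := h.dvd_succ n hn
    rw [hUp.integral, hq, add_nat_mul_period (h.pow_eq_one n hn')
      (quasiPrim_add_quasiperiod (h.quasi hn')), sub_self]

lemma towerMean_of_neg_one (hz : ∀ i < v, z i = -1) {n : ℕ} (hn : n ≤ v) :
    towerMean L z n = ((∏ i ∈ Finset.range n, L i / 2 : ℝ) : ℂ) := by
  rw [towerMean]
  push_cast
  refine Finset.prod_congr rfl fun i hi => ?_
  rw [hz i ((Finset.mem_range.mp hi).trans_le hn)]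
  norm_num

/-- The bound for `n` says that `r + P` is nonnegative, so the modulus of the next integrand is `r +
P` itself. As `r` has mean zero over a period, its integral is exactly `L n * P`, and the factor `1
/ 2` from `z - 1 = -2` gives the bound for `n + 1` without loss. -/
lemma towerPrim_real (h : StepTower b v L z) (hz : ∀ i < v, z i = -1) {n : ℕ} (hn : n ≤ v) :
    ∃ r : ℝ → ℝ, (∀ x, towerPrim L z n x = r x) ∧
      ∀ x, |r x| ≤ ∏ i ∈ Finset.range n, L i / 2 := by
  induction n with
  | zero => exact ⟨0, fun x => by simp [towerPrim], fun x => by simp⟩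
  | succ n ih =>
    obtain ⟨r, hr, hrb⟩ := ih (by omega)
    have hn' : n < v := hn
    set P := ∏ i ∈ Finset.range n, L i / 2 with hP
    have hL := h.pos n hn'
    have hg : ∀ t, (towerPrim L z n t + towerMean L z n) * stepChar (L n) (z n) t
        = (((r t + P) * (-1) ^ ⌊t / L n⌋ : ℝ) : ℂ) := by
      intro t
      rw [hr, towerMean_of_neg_one hz hn'.le, ← hP, hz n hn', stepChar]
      push_cast
      rfl
    have hreal : ∀ x, towerPrim L z (n + 1) x
        = (((-1 - 1)⁻¹ * ∫ t in x..x + L n, (r t + P) * (-1) ^ ⌊t / L n⌋ : ℝ) : ℂ) := by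
      intro x
      rw [towerPrim, quasiPrim, hz n hn']
      push_cast
      rw [← intervalIntegral.integral_ofReal]
      congr 2
      funext t
      rw [← hz n hn', hg]
    refine ⟨_, hreal, fun x => ?_⟩
    rw [← Real.norm_eq_abs, ← Complex.norm_real, ← hreal, towerPrim, quasiPrim, hz n hn', norm_mul,
      Finset.prod_range_succ, ← hP]
    have hnorm : ∀ t, ‖(towerPrim L z n t + towerMean L z n) * stepChar (L n) (-1) t‖ = r t + P := by
      intro t
      rw [norm_mul, norm_stepChar (by simp), mul_one, hr, towerMean_of_neg_one hz hn'.le,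
        ← Complex.ofReal_add, Complex.norm_real, Real.norm_eq_abs, abs_of_nonneg]
      linarith [neg_abs_le (r t), hrb t]
    have hval : ∫ t in x..x + L n, (r t + P) = L n * P := by
      have : ((∫ t in x..x + L n, (r t + P) : ℝ) : ℂ) = ((L n * P : ℝ) : ℂ) := by
        rw [← intervalIntegral.integral_ofReal]
        push_cast
        simp_rw [← hr]
        rw [intervalIntegral.integral_add
          ((h.continuous_and_periodic hn').1.intervalIntegrable _ _) intervalIntegrable_const,
          h.integral_towerPrim hn']
        simp
      exact_mod_cast this
    have hle := intervalIntegral.norm_integral_le_integral_norm (μ := volume)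
      (f := fun t => (towerPrim L z n t + towerMean L z n) * stepChar (L n) (-1) t)
      (show x ≤ x + L n by linarith)
    simp_rw [hnorm] at hle
    rw [hval] at hle
    norm_num
    linarith

lemma towerPrim_neg (h : StepTower b v L z) (hz : ∀ i < v, z i = -1) {n : ℕ} (hn : n ≤ v)
    (x : ℝ) : towerPrim L z n (-x) = towerPrim L z n x := by
  induction n generalizing x with
  | zero => rfl
  | succ n ih =>
    have hn' : n < v := hn
    have hq := h.quasi_aux hn' (h.continuous_and_periodic hn').2
    have hodd := stepChar_neg_one_neg (h.pos n hn').ne'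
    rw [hz n hn'] at hq
    have := quasiPrim_neg (L := L n) (ε := -1)
      (g := fun x => (towerPrim L z n x + towerMean L z n) * stepChar (L n) (-1) x) hq
      (by
        filter_upwards [hodd] with t ht
        rw [ht, ih hn'.le]
        ring) x
    rw [towerPrim, hz n hn', this]
    ring

lemma iterPrim_neg (h : StepTower b v L z) (hz : ∀ i < v, z i = -1) (hv : 0 < v) (j : ℕ)
    (x : ℝ) : iterPrim v L z (v + j) (-x) = (-1) ^ j * iterPrim v L z (v + j) x := by
  induction j generalizing x with
  | zero => rw [add_zero, iterPrim_self, h.towerPrim_neg hz le_rfl]; simp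
  | succ j ih =>
    have hq := (h.iterPrim_quasi hv (Nat.le_add_right v j)).2
    rw [hz (v - 1) (by omega)] at hq
    rw [← add_assoc, iterPrim_succ (Nat.le_add_right v j), hz (v - 1) (by omega),
      quasiPrim_neg hq (Filter.Eventually.of_forall ih)]
    ring

lemma iterPrim_zero_of_odd (h : StepTower b v L z) (hz : ∀ i < v, z i = -1) (hv : 0 < v) {j : ℕ}
    (hj : Odd j) : iterPrim v L z (v + j) 0 = 0 := by
  have := h.iterPrim_neg hz hv j 0
  rw [neg_zero, hj.neg_one_pow] at this
  linear_combination this / 2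

lemma norm_towerPrim_le_of_neg_one (h : StepTower b v L z) (hz : ∀ i < v, z i = -1) {n : ℕ}
    (hn : n ≤ v) (x : ℝ) : ‖towerPrim L z n x‖ ≤ ∏ i ∈ Finset.range n, L i / 2 := by
  obtain ⟨r, hr, hrb⟩ := h.towerPrim_real hz hn
  rw [hr, Complex.norm_real]
  exact hrb x

end StepTower

/-! ### Integration by parts on the Sobolev space -/

lemma AbsolutelyContinuousOnInterval.integral_mul_eq_sub {F G g : ℝ → ℝ} {a b : ℝ}
    (hF : AbsolutelyContinuousOnInterval F a b)
    (hg : IntervalIntegrable g volume a b) (hG : ∀ x, G x = G a + ∫ t in a..x, g t) :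
    ∫ x in a..b, F x * g x = F b * G b - F a * G a - ∫ x in a..b, deriv F x * G x := by
  have hP := hg.absolutelyContinuousOnInterval_intervalIntegral (c := a) Set.left_mem_uIcc
  have hparts := hF.integral_mul_deriv_eq_deriv_mul hP
  have hd : ∫ x in a..b, F x * deriv (fun x => ∫ t in a..x, g t) x = ∫ x in a..b, F x * g x := by
    apply intervalIntegral.integral_congr_ae
    filter_upwards [hg.ae_hasDerivAt_integral] with x hx hx'
    rw [(hx (Set.uIoc_subset_uIcc hx') a Set.left_mem_uIcc).deriv]
  have hI := hF.intervalIntegrable_deriv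
  have hFTC := hF.integral_deriv_eq_sub
  have hsplit : ∫ x in a..b, deriv F x * G x
      = (∫ x in a..b, deriv F x) * G a + ∫ x in a..b, deriv F x * ∫ t in a..x, g t := by
    rw [← intervalIntegral.integral_mul_const, ← intervalIntegral.integral_add]
    · refine intervalIntegral.integral_congr fun x _ => ?_
      rw [hG x]
      ring
    · exact hI.mul_const _
    · exact hI.mul_continuousOn hP.continuousOn
  rw [← hd, hparts, hsplit, hFTC, hG b]
  simp
  ring

lemma integral_mul_of_isPrimitive {F : ℝ → ℝ} {G g : ℝ → ℂ} {a b : ℝ}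
    (hF : AbsolutelyContinuousOnInterval F a b) (h : IsPrimitive G g) :
    ∫ x in a..b, (F x : ℂ) * g x
      = F b * G b - F a * G a - ∫ x in a..b, ((deriv F x : ℝ) : ℂ) * G x := by
  have hgi := h.integrable a b
  have hre : IntervalIntegrable (fun x => (g x).re) volume a b := by
    rw [intervalIntegrable_iff] at hgi ⊢
    exact hgi.re
  have him : IntervalIntegrable (fun x => (g x).im) volume a b := by
    rw [intervalIntegrable_iff] at hgi ⊢
    exact hgi.im
  have hint1 : IntervalIntegrable (fun x => (F x : ℂ) * g x) volume a b :=
    hgi.continuousOn_mul (Complex.continuous_ofReal.comp_continuousOn hF.continuousOn)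
  have hd : IntervalIntegrable (fun x => ((deriv F x : ℝ) : ℂ)) volume a b :=
    ⟨hF.intervalIntegrable_deriv.1.ofReal, hF.intervalIntegrable_deriv.2.ofReal⟩
  have hint2 : IntervalIntegrable (fun x => ((deriv F x : ℝ) : ℂ) * G x) volume a b :=
    hd.mul_continuousOn h.continuous.continuousOn
  have hGre : ∀ x, (G x).re = (G a).re + ∫ t in a..x, (g t).re := by
    intro x
    have : ∫ t in a..x, (g t).re = (∫ t in a..x, g t).re :=
      intervalIntegral.intervalIntegral_re (𝕜 := ℂ) (h.integrable a x)
    rw [this, h.integral]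
    simp
  have hGim : ∀ x, (G x).im = (G a).im + ∫ t in a..x, (g t).im := by
    intro x
    have : ∫ t in a..x, (g t).im = (∫ t in a..x, g t).im :=
      intervalIntegral.intervalIntegral_im (𝕜 := ℂ) (h.integrable a x)
    rw [this, h.integral]
    simp
  have h1 := hF.integral_mul_eq_sub hre hGre
  have h2 := hF.integral_mul_eq_sub him hGim
  apply Complex.ext
  · have e1 : ∫ x in a..b, ((F x : ℂ) * g x).re = (∫ x in a..b, (F x : ℂ) * g x).re :=
      intervalIntegral.intervalIntegral_re (𝕜 := ℂ) hint1
    have e2 : ∫ x in a..b, (((deriv F x : ℝ) : ℂ) * G x).re = (∫ x in a..b, ((deriv F x : ℝ) : ℂ) * G x).re :=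
      intervalIntegral.intervalIntegral_re (𝕜 := ℂ) hint2
    rw [Complex.sub_re, ← e1, ← e2]
    simpa using h1
  · have e1 : ∫ x in a..b, ((F x : ℂ) * g x).im = (∫ x in a..b, (F x : ℂ) * g x).im :=
      intervalIntegral.intervalIntegral_im (𝕜 := ℂ) hint1
    have e2 : ∫ x in a..b, (((deriv F x : ℝ) : ℂ) * G x).im = (∫ x in a..b, ((deriv F x : ℝ) : ℂ) * G x).im :=
      intervalIntegral.intervalIntegral_im (𝕜 := ℂ) hint2
    rw [Complex.sub_im, ← e1, ← e2]
    simpa using h2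

lemma derivUnit_succ_eq_deriv {f : ℝ → ℝ} (i : ℕ) {x : ℝ} (hx : x ∈ Set.Ioo (0 : ℝ) 1) :
    derivUnit (i + 1) f x = deriv (derivUnit i f) x := by
  rw [derivUnit, iteratedDerivWithin_succ, derivWithin_of_mem_nhds (Icc_mem_nhds hx.1 hx.2)]
  rfl

lemma intervalIntegral_congr_Ioo {E : Type*} [NormedAddCommGroup E] [NormedSpace ℝ E]
    {F G : ℝ → E} (h : ∀ x ∈ Set.Ioo (0 : ℝ) 1, F x = G x) :
    ∫ x in (0 : ℝ)..1, F x = ∫ x in (0 : ℝ)..1, G x := by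
  apply intervalIntegral.integral_congr_ae
  have : ∀ᵐ t : ℝ, t ≠ 1 := by simp [ae_iff]
  filter_upwards [this] with x hx hx'
  rw [Set.uIoc_of_le zero_le_one] at hx'
  exact h x ⟨hx'.1, lt_of_le_of_ne hx'.2 hx⟩

lemma MemSobolevUnit.integral_eq_sub {α : ℕ} {f : ℝ → ℝ} (hf : MemSobolevUnit α f) {i : ℕ}
    (hi : i < α) : ∫ x in (0 : ℝ)..1, derivUnit (i + 1) f x = derivUnit i f 1 - derivUnit i f 0 := by
  rw [← (hf.absolutelyContinuous i hi).integral_deriv_eq_sub]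
  exact intervalIntegral_congr_Ioo fun x hx => derivUnit_succ_eq_deriv i hx

lemma MemSobolevUnit.integral_mul_iter {α : ℕ} {f : ℝ → ℝ} (hf : MemSobolevUnit α f)
    {ψ : ℕ → ℝ → ℂ} (hψ : ∀ n, IsPrimitive (ψ (n + 1)) (ψ n)) (hper : ∀ n, ψ (n + 1) 1 = ψ (n + 1) 0)
    {n : ℕ} (hn : n ≤ α) :
    ∫ x in (0 : ℝ)..1, (f x : ℂ) * ψ 0 x
      = ∑ i ∈ Finset.range n,
          (-1) ^ i * ψ (i + 1) 0 * ((∫ x in (0 : ℝ)..1, derivUnit (i + 1) f x : ℝ) : ℂ)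
        + (-1) ^ n * ∫ x in (0 : ℝ)..1, (derivUnit n f x : ℂ) * ψ n x := by
  induction n with
  | zero => simp [derivUnit]
  | succ n ih =>
    rw [ih (by omega), Finset.sum_range_succ, integral_mul_of_isPrimitive
      (hf.absolutelyContinuous n hn) (hψ n), hper, hf.integral_eq_sub hn]
    have : ∫ x in (0 : ℝ)..1, (derivUnit (n + 1) f x : ℂ) * ψ (n + 1) x
        = ∫ x in (0 : ℝ)..1, ((deriv (derivUnit n f) x : ℝ) : ℂ) * ψ (n + 1) x :=
      intervalIntegral_congr_Ioo fun x hx => by rw [derivUnit_succ_eq_deriv n hx]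
    rw [this]
    push_cast
    ring

lemma MemSobolevUnit.intervalIntegrable {α : ℕ} {f : ℝ → ℝ} (hf : MemSobolevUnit α f) :
    IntervalIntegrable (derivUnit α f) volume 0 1 := by
  rw [intervalIntegrable_iff_integrableOn_Icc_of_le zero_le_one]
  exact hf.memLp.integrable (by norm_num)

lemma MemSobolevUnit.norm_integral_mul_le {α : ℕ} {f : ℝ → ℝ} (hf : MemSobolevUnit α f)
    {ψ : ℕ → ℝ → ℂ} (hψ : ∀ n, IsPrimitive (ψ (n + 1)) (ψ n)) (hper : ∀ n, ψ (n + 1) 1 = ψ (n + 1) 0)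
    {K : ℝ} (hK : ∀ x, ‖ψ α x‖ ≤ K) :
    ‖∫ x in (0 : ℝ)..1, (f x : ℂ) * ψ 0 x‖
      ≤ ∑ i ∈ Finset.Icc 1 α, |∫ x in (0 : ℝ)..1, derivUnit i f x| * ‖ψ i 0‖
        + (∫ x in (0 : ℝ)..1, |derivUnit α f x|) * K := by
  rw [hf.integral_mul_iter hψ hper le_rfl]
  refine (norm_add_le _ _).trans (add_le_add ?_ ?_)
  · have hshift : ∑ i ∈ Finset.Icc 1 α, |∫ x in (0 : ℝ)..1, derivUnit i f x| * ‖ψ i 0‖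
        = ∑ i ∈ Finset.range α, |∫ x in (0 : ℝ)..1, derivUnit (i + 1) f x| * ‖ψ (i + 1) 0‖ := by
      rw [Finset.range_eq_Ico, Finset.sum_Ico_add'
        (fun i => |∫ x in (0 : ℝ)..1, derivUnit i f x| * ‖ψ i 0‖) 0 α 1]
      rfl
    rw [hshift]
    refine (norm_sum_le _ _).trans (Finset.sum_le_sum fun i _ => ?_)
    rw [norm_mul, norm_mul, norm_pow, norm_neg, norm_one, one_pow, one_mul, Complex.norm_real,
      Real.norm_eq_abs, mul_comm]
  · rw [norm_mul, norm_pow, norm_neg, norm_one, one_pow, one_mul,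
      ← intervalIntegral.integral_mul_const]
    refine intervalIntegral.norm_integral_le_of_norm_le zero_le_one ?_
      (hf.intervalIntegrable.abs.mul_const K)
    refine Filter.Eventually.of_forall fun x _ => ?_
    rw [norm_mul, Complex.norm_real, Real.norm_eq_abs]
    exact mul_le_mul_of_nonneg_left (hK x) (abs_nonneg _)

/-! ### Distances of roots of unity from 1 and the constants -/

lemma norm_one_sub_conj_exp_pow {b c : ℕ} (hc : c ≤ b) :
    ‖1 - starRingEnd ℂ (Complex.exp (2 * Real.pi * Complex.I / b)) ^ c‖
      = 2 * Real.cos (Real.pi / 2 - Real.pi * c / b) := by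
  have h1 : Complex.exp (2 * Real.pi * Complex.I / b) ^ c
      = Complex.exp (Complex.I * ((2 * Real.pi * c / b : ℝ) : ℂ)) := by
    rw [← Complex.exp_nat_mul]
    congr 1
    push_cast
    ring
  have h2 : 1 - starRingEnd ℂ (Complex.exp (2 * Real.pi * Complex.I / b)) ^ c
      = starRingEnd ℂ (1 - Complex.exp (2 * Real.pi * Complex.I / b) ^ c) := by
    simp
  rw [h2, RCLike.norm_conj, norm_sub_rev, h1, Complex.norm_exp_I_mul_ofReal_sub_one,
    Real.cos_pi_div_two_sub, show 2 * Real.pi * c / b / 2 = Real.pi * c / b by ring,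
    Real.norm_of_nonneg]
  have : (c : ℝ) / b ≤ 1 := div_le_one_of_le₀ (by exact_mod_cast hc) (by positivity)
  have := Real.sin_nonneg_of_nonneg_of_le_pi (x := Real.pi * c / b) (by positivity)
    (by rw [mul_div_assoc]; nlinarith [Real.pi_pos])
  positivity

lemma finite_rootDistances (b : ℕ) : (rootDistances b).Finite := (Set.finite_Icc _ _).image _

lemma nonempty_rootDistances {b : ℕ} (hb : 2 ≤ b) : (rootDistances b).Nonempty :=
  ⟨_, Set.mem_image_of_mem _ (Set.mem_Icc.mpr ⟨le_rfl, by omega⟩)⟩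

lemma mMin_le {b c : ℕ} (hc : c ∈ Set.Icc 1 (b - 1)) :
    mMin b ≤ ‖1 - starRingEnd ℂ (Complex.exp (2 * Real.pi * Complex.I / b)) ^ c‖ :=
  csInf_le (finite_rootDistances b).bddBelow (Set.mem_image_of_mem _ hc)

lemma le_mMax {b c : ℕ} (hc : c ∈ Set.Icc 1 (b - 1)) :
    ‖1 - starRingEnd ℂ (Complex.exp (2 * Real.pi * Complex.I / b)) ^ c‖ ≤ mMax b :=
  le_csSup (finite_rootDistances b).bddAbove (Set.mem_image_of_mem _ hc)

lemma mMax_le_two {b : ℕ} (hb : 2 ≤ b) : mMax b ≤ 2 := by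
  refine csSup_le (nonempty_rootDistances hb) ?_
  rintro _ ⟨c, hc, rfl⟩
  simp only
  rw [norm_one_sub_conj_exp_pow (hc.2.trans (Nat.sub_le _ _))]
  linarith [Real.cos_le_one (Real.pi / 2 - Real.pi * c / b)]

/-- Jordan's inequality `sin x ≥ 2 x / π` on `[0, π/2]`, applied to `π c / b` or to its reflection.
-/
lemma four_div_le_mMin {b : ℕ} (hb : 2 ≤ b) : 4 / (b : ℝ) ≤ mMin b := by
  refine le_csInf (nonempty_rootDistances hb) ?_
  rintro _ ⟨c, hc, rfl⟩
  simp only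
  have hb0 : (0 : ℝ) < b := by exact_mod_cast (by omega : 0 < b)
  have hc1 : (1 : ℝ) ≤ c := by exact_mod_cast hc.1
  have hc2 : (c : ℝ) + 1 ≤ b := by
    have := hc.2
    exact_mod_cast (by omega : c + 1 ≤ b)
  have hlow : 1 / (b : ℝ) ≤ c / b := by gcongr
  have hhigh : (c : ℝ) / b ≤ 1 - 1 / b := by
    rw [le_sub_iff_add_le, ← add_div, div_le_one hb0]
    exact hc2
  rw [norm_one_sub_conj_exp_pow (hc.2.trans (Nat.sub_le _ _)), Real.cos_pi_div_two_sub,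
    mul_div_assoc]
  have hpi := Real.pi_pos
  have hsin : 2 / (b : ℝ) ≤ Real.sin (Real.pi * (c / b)) := by
    rcases le_total ((c : ℝ) / b) (1 / 2) with h | h
    · have := Real.mul_le_sin (x := Real.pi * (c / b)) (by positivity) (by nlinarith)
      rw [← mul_assoc, div_mul_cancel₀ _ hpi.ne'] at this
      refine le_trans ?_ this
      rw [show 2 / (b : ℝ) = 2 * (1 / b) by ring]
      gcongr
    · have := Real.mul_le_sin (x := Real.pi * (1 - c / b)) (by nlinarith [one_div_pos.mpr hb0])
        (by nlinarith)
      rw [← mul_assoc, div_mul_cancel₀ _ hpi.ne', mul_sub Real.pi, mul_one, Real.sin_pi_sub] at this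
      refine le_trans ?_ this
      rw [show 2 / (b : ℝ) = 2 * (1 / b) by ring]
      linarith
  rw [show 4 / (b : ℝ) = 2 * (2 / b) by ring]
  linarith

/-- The two inequalities say that `ω ^ c` is nearly antipodal to 1: the angle in the cosine is at
most `π / (2 b)`. The 5 comes from `π ^ 2 ≤ 10`. -/
lemma two_sub_le_norm {b c : ℕ} (hb : 0 < b) (hc : c ≤ b) (h1 : 2 * c ≤ b + 1) (h2 : b ≤ 2 * c + 1) :
    2 - 5 / (2 * (b : ℝ) ^ 2)
      ≤ ‖1 - starRingEnd ℂ (Complex.exp (2 * Real.pi * Complex.I / b)) ^ c‖ := by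
  have hb0 : (0 : ℝ) < b := by exact_mod_cast hb
  rw [norm_one_sub_conj_exp_pow hc]
  have hcos := Real.one_sub_sq_div_two_le_cos (x := Real.pi / 2 - Real.pi * c / b)
  have e : Real.pi / 2 - Real.pi * c / b = (b - 2 * c) * (Real.pi / (2 * b)) := by
    field_simp
  have hsq : ((b : ℝ) - 2 * c) ^ 2 ≤ 1 := by
    have h1' : 2 * (c : ℝ) ≤ b + 1 := by exact_mod_cast h1
    have h2' : (b : ℝ) ≤ 2 * c + 1 := by exact_mod_cast h2
    nlinarith
  have hpi : Real.pi ^ 2 ≤ 10 := by nlinarith [Real.pi_lt_d2, Real.pi_pos]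
  have : (Real.pi / 2 - Real.pi * c / b) ^ 2 ≤ 5 / (2 * (b : ℝ) ^ 2) := by
    rw [e, mul_pow, div_pow]
    calc _ ≤ 1 * (10 / (2 * (b : ℝ)) ^ 2) := by gcongr
      _ = _ := by ring
  linarith

lemma two_sub_le_mMax {b : ℕ} (hb : 2 ≤ b) : 2 - 5 / (2 * (b : ℝ) ^ 2) ≤ mMax b :=
  (two_sub_le_norm (c := b / 2) (by omega) (by omega) (by omega) (by omega)).trans
    (le_mMax ⟨by omega, by omega⟩)

lemma mMin_pos {b : ℕ} (hb : 2 ≤ b) : 0 < mMin b := by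
  have hb0 : (0 : ℝ) < b := by exact_mod_cast (by omega : 0 < b)
  exact lt_of_lt_of_le (by positivity) (four_div_le_mMin hb)

lemma one_le_mMax {b : ℕ} (hb : 2 ≤ b) : 1 ≤ mMax b := by
  have h := two_sub_le_mMax hb
  have hb0 : (2 : ℝ) ≤ b := by exact_mod_cast hb
  have : 5 / (2 * (b : ℝ) ^ 2) ≤ 1 := by
    rw [div_le_one (by positivity)]
    nlinarith
  linarith

lemma mMin_two : mMin 2 = 2 := by
  have : rootDistances 2 = {2} := by
    have : Set.Icc 1 (2 - 1) = {1} := by simp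
    rw [rootDistances, this, Set.image_singleton, norm_one_sub_conj_exp_pow (by norm_num)]
    simp
  rw [mMin, this, csInf_singleton]

/-- The numerical core: it places `b / (b - 2) + 1` below `mMax b + walshConst b 2`, whose second
term is `mMin b * (1 + mMax b / b)`. -/
lemma mMin_mul_le {b : ℕ} (hb : 2 < b) :
    2 - mMax b + 2 / ((b : ℝ) - 2) ≤ mMin b * (1 + mMax b / b) := by
  have hM := two_sub_le_mMax hb.le
  have hM1 := one_le_mMax hb.le
  have hm := four_div_le_mMin hb.le
  rcases Nat.lt_or_ge 3 b with h | h
  · have hb4 : (4 : ℝ) ≤ b := by exact_mod_cast h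
    have hb0 : (0 : ℝ) < b := by linarith
    have hb2 : (0 : ℝ) < b - 2 := by linarith
    have h1 : 4 / (b : ℝ) * (1 + 1 / b) ≤ mMin b * (1 + mMax b / b) := by
      gcongr
      exact (mMin_pos hb.le).le
    have h2 : 5 / (2 * (b : ℝ) ^ 2) + 2 / ((b : ℝ) - 2) ≤ 4 / (b : ℝ) * (1 + 1 / b) := by
      rw [div_add_div _ _ (by positivity) hb2.ne', show 4 / (b : ℝ) * (1 + 1 / b)
        = (4 * (b + 1)) / (b ^ 2) by field_simp, div_le_div_iff₀ (by positivity) (by positivity)]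
      -- What remains after clearing denominators; true from `b = 4` on, false at 3.
      have h3 : 0 ≤ 2 * (b : ℝ) ^ 2 - 13 / 2 * b - 3 := by nlinarith
      have h4 := mul_nonneg h3 (by positivity : 0 ≤ 2 * (b : ℝ) ^ 2)
      nlinarith
    linarith
  · obtain rfl : b = 3 := by omega
    -- For `b = 3` both nontrivial roots are nearly antipodal to 1, so the sharper bound also holds
    -- for the minimum.
    have hm3 : 2 - 5 / (2 * ((3 : ℕ) : ℝ) ^ 2) ≤ mMin 3 := by
      refine le_csInf (nonempty_rootDistances (by norm_num)) ?_
      rintro _ ⟨c, hc, rfl⟩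
      have h1 := hc.1
      have h2 := hc.2
      exact two_sub_le_norm (by omega) (by omega) (by omega) (by omega)
    push_cast at *
    norm_num at *
    nlinarith

lemma walshConst_one {b : ℕ} (hb : 2 < b) : walshConst b 1 = mMin b := by
  have h2 : (2 : ℝ) < b := by exact_mod_cast hb
  have := mMax_le_two hb.le
  have h3 : (b : ℝ) - mMax b ≠ 0 := by linarith
  rw [walshConst]
  field_simp

lemma mMin_mul_le_walshConst {b v : ℕ} (hb : 2 < b) (hv : 2 ≤ v) :
    mMin b * (1 + mMax b / b) ≤ walshConst b v := by
  have h2 : (2 : ℝ) < b := by exact_mod_cast hb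
  have h4 := mMax_le_two hb.le
  have h5 := one_le_mMax hb.le
  have h3 : 0 < (b : ℝ) - mMax b := by linarith
  have hm := mMin_pos hb.le
  have hpow : (mMax b / b) ^ v ≤ (mMax b / b) ^ 2 :=
    pow_le_pow_of_le_one (by positivity) ((div_le_one (by linarith)).mpr (by linarith)) hv
  calc mMin b * (1 + mMax b / b)
      = b * mMin b / (b - mMax b) * (1 - (mMax b / b) ^ 2) := by field_simp; ring
    _ ≤ _ := by
        rw [walshConst]
        gcongr

lemma div_sub_two_le {b v : ℕ} (hb : 2 < b) (hv : 2 ≤ v) :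
    (b : ℝ) / (b - 2) + 1 ≤ mMax b + walshConst b v := by
  have h2 : (2 : ℝ) < b := by exact_mod_cast hb
  have h := (mMin_mul_le hb).trans (mMin_mul_le_walshConst hb hv)
  have : (b : ℝ) / (b - 2) = 1 + 2 / (b - 2) := by
    have : (b : ℝ) - 2 ≠ 0 := by linarith
    field_simp
    ring
  linarith

/-! ### Digits of `k` and the tower of a Walsh function -/

lemma mem_walshPositions {b k a : ℕ} (ha : a ∈ walshPositions b k) :
    1 ≤ a ∧ walshDigit b k a ≠ 0 := by
  rw [walshPositions, Finset.mem_filter, Finset.mem_Icc] at ha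
  exact ⟨ha.1.1, ha.2⟩

lemma walshDigit_lt {b : ℕ} (hb : 2 ≤ b) (k a : ℕ) : walshDigit b k a < b := by
  rw [walshDigit]
  rcases lt_or_ge (a - 1) (Nat.digits b k).length with h | h
  · rw [List.getD_eq_getElem _ _ h]
    exact Nat.digits_lt_base hb (List.getElem_mem h)
  · rw [List.getD_eq_default _ _ h]
    omega

lemma walshWeight_pos {b k : ℕ} (hk : 0 < k) : 0 < walshWeight b k := by
  have hne : Nat.digits b k ≠ [] := Nat.digits_ne_nil_iff_ne_zero.mpr hk.ne'
  have hlen := List.length_pos_iff.mpr hne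
  refine Finset.card_pos.mpr ⟨(Nat.digits b k).length, ?_⟩
  rw [walshPositions, Finset.mem_filter, Finset.mem_Icc]
  refine ⟨⟨hlen, le_rfl⟩, ?_⟩
  rw [walshDigit, List.getD_eq_getElem _ _ (by omega), ← List.getLast_eq_getElem hne]
  exact Nat.getLast_digit_ne_zero b hk.ne'

lemma walshPos_mem {b k i : ℕ} (hi : i < walshWeight b k) :
    walshPos b k (i + 1) ∈ walshPositions b k := by
  rw [walshPos, List.getD_eq_getElem _ _ (by simpa [walshWeight] using hi), ← Finset.mem_sort (· ≥ ·)]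
  exact List.getElem_mem _

lemma walshPos_lt {b k i j : ℕ} (hij : i < j) (hj : j < walshWeight b k) :
    walshPos b k (j + 1) < walshPos b k (i + 1) := by
  have hj' : j < ((walshPositions b k).sort (· ≥ ·)).length := by simpa [walshWeight] using hj
  have hi' : i < ((walshPositions b k).sort (· ≥ ·)).length := hij.trans hj'
  rw [walshPos, walshPos, Nat.add_sub_cancel, Nat.add_sub_cancel, List.getD_eq_getElem _ _ hj',
    List.getD_eq_getElem _ _ hi']
  have h1 := List.pairwise_iff_getElem.mp 
    (Finset.pairwise_sort (walshPositions b k) (· ≥ ·)) i j hi' hj' hij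
  refine lt_of_le_of_ne h1 fun h => ?_
  have := (List.Nodup.getElem_inj_iff (Finset.sort_nodup (walshPositions b k) (· ≥ ·))).mp h
  omega

lemma prod_walshPositions {b k : ℕ} (F : ℕ → ℂ) :
    ∏ a ∈ walshPositions b k, F a = ∏ i ∈ Finset.range (walshWeight b k), F (walshPos b k (i + 1)) := by
  have hinj : Set.InjOn (fun i => walshPos b k (i + 1)) (Finset.range (walshWeight b k)) := by
    intro i hi j hj h
    simp only [Finset.coe_range, Set.mem_Iio] at hi hj
    rcases lt_trichotomy i j with h' | h' | h'
    · exact absurd h (walshPos_lt h' hj).ne'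
    · exact h'
    · exact absurd h (walshPos_lt h' hi).ne
  have himg : (Finset.range (walshWeight b k)).image (fun i => walshPos b k (i + 1))
      = walshPositions b k := by
    refine Finset.eq_of_subset_of_card_le ?_ ?_
    · intro a ha
      obtain ⟨i, hi, rfl⟩ := Finset.mem_image.mp ha
      exact walshPos_mem (Finset.mem_range.mp hi)
    · rw [Finset.card_image_of_injOn hinj, Finset.card_range, walshWeight]
  rw [← himg, Finset.prod_image hinj]

/-- The lengths `b ^ (-a_i)` attached to the nonzero digits of `k`, indexed from `0`. -/
noncomputable def walshLength (b k i : ℕ) : ℝ := ((b : ℝ) ^ walshPos b k (i + 1))⁻¹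

/-- The roots of unity `ω ^ (-κ_i)` attached to the nonzero digits of `k`, indexed from `0`. -/
noncomputable def walshRoot (b k i : ℕ) : ℂ :=
  starRingEnd ℂ (Complex.exp (2 * Real.pi * Complex.I / b)) ^ walshDigit b k (walshPos b k (i + 1))

lemma conj_exp_pow {b : ℕ} (hb : b ≠ 0) :
    starRingEnd ℂ (Complex.exp (2 * Real.pi * Complex.I / b)) ^ b = 1 := by
  rw [← map_pow, (Complex.isPrimitiveRoot_exp b hb).pow_eq_one, map_one]

lemma mMin_le_walshRoot {b k i : ℕ} (hb : 2 ≤ b) (hi : i < walshWeight b k) :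
    mMin b ≤ ‖1 - walshRoot b k i‖ := by
  have h1 := (mem_walshPositions (walshPos_mem hi)).2
  have h2 := walshDigit_lt hb k (walshPos b k (i + 1))
  exact mMin_le ⟨by omega, by omega⟩

lemma walshRoot_pow {b : ℕ} (hb : b ≠ 0) (k i : ℕ) : walshRoot b k i ^ b = 1 := by
  rw [walshRoot, pow_right_comm, conj_exp_pow hb, one_pow]

lemma stepTower_walsh {b k : ℕ} (hb : 2 ≤ b) :
    StepTower b (walshWeight b k) (walshLength b k) (walshRoot b k) := by
  have hb0 : (0 : ℝ) < b := by exact_mod_cast (by omega : 0 < b)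
  refine ⟨fun i _ => by unfold walshLength; positivity, fun i _ => ?_, fun i hi h => ?_,
    fun i _ => walshRoot_pow (by omega) k i, fun i hi => ?_, fun i hi => ?_⟩
  · exact Complex.norm_eq_one_of_pow_eq_one (walshRoot_pow (by omega) k i) (by omega)
  · have := mMin_le_walshRoot hb hi
    rw [h, sub_self, norm_zero] at this
    exact absurd (mMin_pos hb) (not_lt.mpr this)
  · have hlt := walshPos_lt (Nat.lt_succ_self i) hi
    obtain ⟨d, hd⟩ := Nat.exists_eq_add_of_lt hlt
    refine ⟨b ^ d, ?_⟩
    rw [walshLength, walshLength, hd, pow_succ, pow_add]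
    push_cast
    field_simp
  · obtain ⟨d, hd⟩ := Nat.exists_eq_add_of_le (mem_walshPositions (walshPos_mem hi)).1
    refine ⟨b ^ d, ?_⟩
    rw [walshLength, hd, pow_add]
    push_cast
    field_simp

/-- The digit is `⌊x * b ^ a⌋` reduced mod `b`; the reduction is invisible to a `b`-th root of
unity. -/
lemma conj_walsh {b : ℕ} [NeZero b] {k : ℕ} {x : ℝ} (hx : 0 ≤ x) :
    starRingEnd ℂ (walsh b k x) = ∏ i ∈ Finset.range (walshWeight b k),
      stepChar (walshLength b k i) (walshRoot b k i) x := by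
  rw [walsh, map_pow, ← Finset.prod_pow_eq_pow_sum, prod_walshPositions]
  refine Finset.prod_congr rfl fun i hi => ?_
  have h1 := (mem_walshPositions (walshPos_mem (Finset.mem_range.mp hi))).1
  rw [pow_mul, ← walshRoot, stepChar, walshLength, div_inv_eq_mul,
    ← Int.natCast_floor_eq_floor (by positivity), zpow_natCast, Real.digits, Nat.sub_add_cancel h1,
    Fin.val_ofNat,
    ← pow_eq_pow_mod _ (walshRoot_pow (NeZero.ne b) k i)]

lemma walshCoeff_eq {b : ℕ} [NeZero b] {k : ℕ} (hk : 0 < k) (f : ℝ → ℝ) :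
    walshCoeff b f k = ∫ x in (0 : ℝ)..1, (f x : ℂ)
      * iterPrim (walshWeight b k) (walshLength b k) (walshRoot b k) 0 x := by
  rw [walshCoeff, intervalIntegral.integral_of_le zero_le_one, ← integral_Ico_eq_integral_Ioc]
  refine setIntegral_congr_fun measurableSet_Ico fun x hx => ?_
  rw [conj_walsh hx.1, StepTower.iterPrim_of_lt (walshWeight_pos hk)]
  simp [towerPrim, towerMean]

lemma sum_walshPos (b k n : ℕ) :
    ∑ i ∈ Finset.Icc 1 n, walshPos b k i = ∑ i ∈ Finset.range n, walshPos b k (i + 1) := by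
  rw [Finset.range_eq_Ico, Finset.sum_Ico_add' (fun i => walshPos b k i) 0 n 1]
  rfl

lemma prod_walshLength (b k n : ℕ) (m : ℝ) :
    ∏ i ∈ Finset.range n, walshLength b k i / m
      = ((b : ℝ) ^ ∑ i ∈ Finset.Icc 1 n, walshPos b k i)⁻¹ / m ^ n := by
  rw [sum_walshPos, Finset.prod_div_distrib, Finset.prod_const, Finset.card_range,
    ← Finset.prod_pow_eq_pow_sum, ← Finset.prod_inv_distrib]
  rfl

lemma scale_of_le {b k n : ℕ} (hk : 0 < k) (hn : n ≤ walshWeight b k) (m : ℝ) :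
    ∏ i ∈ Finset.range n, walshLength b k i / m = (b : ℝ) ^ (-(muPer b n k : ℤ)) / m ^ n := by
  rw [prod_walshLength, zpow_neg, zpow_natCast, muPer, if_neg hk.ne']
  split_ifs with h
  · obtain rfl : n = walshWeight b k := le_antisymm hn h
    simp
  · rfl

lemma scale_of_ge {b k n : ℕ} (hk : 0 < k) (hn : walshWeight b k ≤ n) (m : ℝ) :
    (walshLength b k (walshWeight b k - 1) / m) ^ (n - walshWeight b k)
        * ∏ i ∈ Finset.range (walshWeight b k), walshLength b k i / m
      = (b : ℝ) ^ (-(muPer b n k : ℤ)) / m ^ n := by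
  have hv := walshWeight_pos (b := b) hk
  rw [prod_walshLength, zpow_neg, zpow_natCast, muPer, if_neg hk.ne', if_pos hn, walshLength,
    Nat.sub_add_cancel hv]
  obtain ⟨d, hd⟩ := Nat.exists_eq_add_of_le hn
  generalize walshWeight b k = v at *
  subst hd
  rw [Nat.add_sub_cancel_left, div_pow, pow_add, pow_add, mul_comm d, pow_mul, inv_pow, mul_inv]
  ring

lemma walshRoot_two {k i : ℕ} (hi : i < walshWeight 2 k) : walshRoot 2 k i = -1 := by
  have h1 := (mem_walshPositions (walshPos_mem hi)).2
  have h2 := walshDigit_lt le_rfl k (walshPos 2 k (i + 1))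
  have h3 : walshDigit 2 k (walshPos 2 k (i + 1)) = 1 := by omega
  have h4 : (2 * Real.pi * Complex.I / (2 : ℕ) : ℂ) = Real.pi * Complex.I := by
    push_cast
    ring
  rw [walshRoot, h3, pow_one, h4, Complex.exp_pi_mul_I]
  simp

/-! ### Bounds for the Walsh primitives and conclusion -/

lemma norm_towerPrim_walsh_le {b k : ℕ} (hb : 2 < b) (hk : 0 < k) (x : ℝ) :
    ‖towerPrim (walshLength b k) (walshRoot b k) (walshWeight b k) x‖
      ≤ (1 + walshConst b (walshWeight b k))
        * ∏ i ∈ Finset.range (walshWeight b k), walshLength b k i / mMin b := by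
  have hT := stepTower_walsh (k := k) hb.le
  have hv := walshWeight_pos (b := b) hk
  have hm := mMin_pos hb.le
  have hmz := fun i (hi : i < walshWeight b k) => mMin_le_walshRoot hb.le hi
  have hP := hT.prod_div_nonneg hm le_rfl
  rcases Nat.lt_or_ge 1 (walshWeight b k) with h | h
  · have h1 := hT.norm_towerPrim_le hm hmz hb (n := walshWeight b k - 1) (by omega) x
    rw [Nat.sub_add_cancel hv] at h1
    refine h1.trans (mul_le_mul_of_nonneg_right ?_ hP)
    linarith [div_sub_two_le hb h, mMax_le_two hb.le]
  -- The comparison of constants needs `v ≥ 2`; for a single digit the constant 1 suffices.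
  · have hv1 : walshWeight b k = 1 := by omega
    have h1 := hT.norm_towerPrim_one_le hm hmz hv x
    rw [hv1] at hP ⊢
    rw [walshConst_one hb]
    exact h1.trans (le_mul_of_one_le_left hP (by linarith))

lemma norm_iterPrim_walsh_le {b k n : ℕ} (hb : 2 < b) (hk : 0 < k)
    (hn : walshWeight b k ≤ n) (x : ℝ) :
    ‖iterPrim (walshWeight b k) (walshLength b k) (walshRoot b k) n x‖
      ≤ (b : ℝ) ^ (-(muPer b n k : ℤ)) / mMin b ^ n * (1 + walshConst b (walshWeight b k)) := by
  refine ((stepTower_walsh hb.le).norm_iterPrim_le_of_le (mMin_pos hb.le)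
    (fun i hi => mMin_le_walshRoot hb.le hi) (walshWeight_pos hk)
    (norm_towerPrim_walsh_le hb hk) hn x).trans (le_of_eq ?_)
  rw [← scale_of_ge hk hn]
  ring

lemma norm_iterPrim_walsh_le' {b k n : ℕ} (hb : 2 < b) (hk : 0 < k) (hn0 : 0 < n) (x : ℝ) :
    ‖iterPrim (walshWeight b k) (walshLength b k) (walshRoot b k) n x‖
      ≤ (b : ℝ) ^ (-(muPer b n k : ℤ)) / mMin b ^ n
        * (mMax b + walshConst b (walshWeight b k)) := by
  have hm := mMin_pos hb.le
  have hS : 0 ≤ (b : ℝ) ^ (-(muPer b n k : ℤ)) / mMin b ^ n := by positivity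
  rcases le_or_gt (walshWeight b k) n with hn | hn
  · refine (norm_iterPrim_walsh_le hb hk hn x).trans (mul_le_mul_of_nonneg_left ?_ hS)
    linarith [one_le_mMax hb.le]
  · have hT := stepTower_walsh (k := k) hb.le
    have hmz := fun i (hi : i < walshWeight b k) => mMin_le_walshRoot hb.le hi
    have h1 := hT.norm_towerPrim_le hm hmz hb (n := n - 1) (by omega)
    rw [Nat.sub_add_cancel hn0] at h1
    refine (hT.norm_iterPrim_le_of_lt hm hmz hn h1 x).trans ?_
    rw [scale_of_le hk hn.le]
    have h2 := mul_le_mul_of_nonneg_left (div_sub_two_le hb (v := walshWeight b k) (by omega)) hS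
    linarith

lemma norm_iterPrim_walsh_two_le {k n : ℕ} (hk : 0 < k) (hn : walshWeight 2 k ≤ n) (x : ℝ) :
    ‖iterPrim (walshWeight 2 k) (walshLength 2 k) (walshRoot 2 k) n x‖
      ≤ (2 : ℝ) ^ (-(muPer 2 n k : ℤ)) / 2 ^ n := by
  have hT := stepTower_walsh (k := k) le_rfl
  have hmz := fun i (hi : i < walshWeight 2 k) => mMin_le_walshRoot le_rfl hi
  rw [mMin_two] at hmz
  refine (hT.norm_iterPrim_le_of_le two_pos hmz (walshWeight_pos hk)
    (hT.norm_towerPrim_le_of_neg_one (fun i hi => walshRoot_two hi) le_rfl) hn x).trans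
    (le_of_eq ?_)
  exact_mod_cast scale_of_ge hk hn 2

lemma norm_iterPrim_walsh_two_le' {k n : ℕ} (hk : 0 < k) (hn0 : 0 < n) (x : ℝ) :
    ‖iterPrim (walshWeight 2 k) (walshLength 2 k) (walshRoot 2 k) n x‖
      ≤ (2 : ℝ) ^ (-(muPer 2 n k : ℤ)) / 2 ^ (n - 1) := by
  have hS : 0 ≤ (2 : ℝ) ^ (-(muPer 2 n k : ℤ)) / 2 ^ n := by positivity
  have hdouble : (2 : ℝ) ^ (-(muPer 2 n k : ℤ)) / 2 ^ (n - 1)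
      = 2 * ((2 : ℝ) ^ (-(muPer 2 n k : ℤ)) / 2 ^ n) := by
    obtain ⟨d, rfl⟩ := Nat.exists_eq_add_of_le hn0
    rw [Nat.add_sub_cancel_left, pow_add]
    field_simp
    simp
  rw [hdouble]
  rcases le_or_gt (walshWeight 2 k) n with hn | hn
  · linarith [norm_iterPrim_walsh_two_le hk hn x]
  · have hT := stepTower_walsh (k := k) le_rfl
    have hmz := fun i (hi : i < walshWeight 2 k) => mMin_le_walshRoot le_rfl hi
    rw [mMin_two] at hmz
    refine (hT.norm_iterPrim_le_of_lt two_pos hmz hn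
      (hT.norm_towerPrim_le_of_neg_one (fun i hi => walshRoot_two hi) hn.le) x).trans
      (le_of_eq ?_)
    have := scale_of_le hk hn.le 2
    push_cast at this
    rw [this]
    ring

lemma norm_walshCoeff_le {b : ℕ} [NeZero b] (hb : 2 ≤ b) {α k : ℕ} (hk : 0 < k) {f : ℝ → ℝ}
    (hf : MemSobolevUnit α f) {K : ℝ}
    (hK : ∀ x, ‖iterPrim (walshWeight b k) (walshLength b k) (walshRoot b k) α x‖ ≤ K) :
    ‖walshCoeff b f k‖ ≤ ∑ i ∈ Finset.Icc (walshWeight b k) α,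
        |∫ x in (0 : ℝ)..1, derivUnit i f x|
          * ‖iterPrim (walshWeight b k) (walshLength b k) (walshRoot b k) i 0‖
      + (∫ x in (0 : ℝ)..1, |derivUnit α f x|) * K := by
  have hT := stepTower_walsh (k := k) hb
  have hv := walshWeight_pos (b := b) hk
  rw [walshCoeff_eq hk]
  refine (hf.norm_integral_mul_le (hT.isPrimitive_iterPrim hv)
    (fun n => hT.iterPrim_one n.succ_pos hv) hK).trans (le_of_eq ?_)
  congr 1
  symm
  -- The terms with `i < v` drop out because the primitives vanish at 0.
  refine Finset.sum_subset (Finset.Icc_subset_Icc_left hv) fun i hi hi' => ?_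
  rw [Finset.mem_Icc] at hi hi'
  rw [hT.iterPrim_zero_of_lt hi.1 (by omega), norm_zero, mul_zero]

theorem mainTheorem5 (b : ℕ) [NeZero b] (hb : 2 ≤ b) (α k : ℕ) (hα : 0 < α) (hk : 0 < k)
    (f : ℝ → ℝ) (hf : MemSobolevUnit α f) :
    (2 < b →
      ‖walshCoeff b f k‖ ≤
        ∑ i ∈ Finset.Icc (walshWeight b k) α,
          |∫ x in (0 : ℝ)..1, derivUnit i f x|
            * ((b : ℝ) ^ (-(muPer b i k : ℤ)) / mMin b ^ i)
            * (1 + walshConst b (walshWeight b k))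
        + (∫ x in (0 : ℝ)..1, |derivUnit α f x|)
            * ((b : ℝ) ^ (-(muPer b α k : ℤ)) / mMin b ^ α)
            * (mMax b + walshConst b (walshWeight b k))) ∧
    (b = 2 →
      ‖walshCoeff b f k‖ ≤
        ∑ i ∈ Finset.Icc (walshWeight b k) α with i ≡ walshWeight b k [MOD 2],
          |∫ x in (0 : ℝ)..1, derivUnit i f x|
            * ((2 : ℝ) ^ (-(muPer b i k : ℤ)) / 2 ^ i)
        + (∫ x in (0 : ℝ)..1, |derivUnit α f x|)
            * ((2 : ℝ) ^ (-(muPer b α k : ℤ)) / 2 ^ (α - 1))) := by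
  refine ⟨fun hb2 => ?_, fun hb2 => ?_⟩
  · refine (norm_walshCoeff_le hb hk hf (norm_iterPrim_walsh_le' hb2 hk hα)).trans
      (add_le_add (Finset.sum_le_sum fun i hi => ?_) (le_of_eq (mul_assoc _ _ _).symm))
    rw [mul_assoc]
    exact mul_le_mul_of_nonneg_left
      (norm_iterPrim_walsh_le hb2 hk (Finset.mem_Icc.mp hi).1 0) (abs_nonneg _)
  · subst hb2
    refine (norm_walshCoeff_le hb hk hf (norm_iterPrim_walsh_two_le' hk hα)).trans
      (add_le_add ?_ le_rfl)
    rw [Finset.sum_filter]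
    refine Finset.sum_le_sum fun i hi => ?_
    have hi' := (Finset.mem_Icc.mp hi).1
    split_ifs with hpar
    · exact mul_le_mul_of_nonneg_left (norm_iterPrim_walsh_two_le hk hi' 0) (abs_nonneg _)
    · obtain ⟨j, rfl⟩ := Nat.exists_eq_add_of_le hi'
      have hj : Odd j := by
        rw [← Nat.not_even_iff_odd, Nat.even_iff]
        intro h
        exact hpar (by rw [Nat.ModEq]; omega)
      rw [(stepTower_walsh hb).iterPrim_zero_of_odd (fun i hi => walshRoot_two hi)
        (walshWeight_pos hk) hj, norm_zero, mul_zero]
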